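/- Let $\mathcal X,\mathcal Y$ be measurable spaces. A (randomized) mechanism $M$ is a Markov kernel from $\mathcal X$ to $\mathcal Y$; $M(x)$ denotes a random variable with the law that the kernel assigns to $x$. Let $\mathcal P$ be a set of probability distributions on $\mathcal X$, and let $\log$ be the base-2 logarithm. For $\mu\in[0,\infty]$, $M$ satisfies $\mu$-CI-LMIP if $\sup_{P_X\in\mathcal P} I(X;M(X))\le\mu$ bits, where $X\sim P_X$. $M$ satisfies $(\epsilon,\delta)$-LDP if $\Pr[M(x)\in E]\le e^{\epsilon}\Pr[M(x')\in E]+\delta$ for all $x,x'\in\mathcal X$ and all measurable $E\subseteq\mathcal Y$. For $\epsilon_0,\epsilon_1\in[0,1]$ let $C_{\mathrm{BAC}}(\epsilon_0,\epsilon_1)$ be the capacity in bits (the supremum of the mutual information over binary input distributions) of the binary asymmetric channel that flips the input $0$ with probability $\epsilon_0$ and the input $1$ with probability $\epsilon_1$. With $H_b(p)=-p\log p-(1-p)\log(1-p)$ it has the following closed form. If $\epsilon_0\le\min\{\epsilon_1,1-\epsilon_1,1/2\}$ and $\epsilon_0+\epsilon_1\ne1$, then $$C_{\mathrm{BAC}}(\epsilon_0,\epsilon_1)=\tfrac{\epsilon_0}{1-\epsilon_0-\epsilon_1}H_b(\epsilon_1)-\tfrac{1-\epsilon_1}{1-\epsilon_0-\epsilon_1}H_b(\epsilon_0)+\log\Big(1+2^{\frac{H_b(\epsilon_0)-H_b(\epsilon_1)}{1-\epsilon_0-\epsilon_1}}\Big).$$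 If $\epsilon_0+\epsilon_1=1$, then $C_{\mathrm{BAC}}(\epsilon_0,\epsilon_1)=0$. Further, $C_{\mathrm{BAC}}(\epsilon_0,\epsilon_1)$ equals $C_{\mathrm{BAC}}(\epsilon_1,\epsilon_0)$ if $\epsilon_0>\epsilon_1$, equals $C_{\mathrm{BAC}}(1-\epsilon_1,1-\epsilon_0)$ if $\epsilon_0>1-\epsilon_1$, and equals $C_{\mathrm{BAC}}(1-\epsilon_0,1-\epsilon_1)$ if $\epsilon_0>1/2$. (a) For $\mu\in[0,\infty]$ and $\epsilon>0$, the maximum $$\delta^{\mathrm{LDP}}_\mu(\epsilon)=\max\big\{\max\{0,\,p_0-e^{\epsilon}p_1,\,p_1-e^{\epsilon}p_0\}\,:\,p_0,p_1\in[0,1],\ C_{\mathrm{BAC}}(p_0,1-p_1)\le\mu\big\}$$ is attained. If $\mathcal P$ contains all distributions of the form $t\,\delta_x+(1-t)\,\delta_{x'}$ with $x,x'\in\mathcal X$, $t\in[0,1]$ (for instance, if $\mathcal P$ is the set of all distributions on $\mathcal X$), then every mechanism that satisfies $\mu$-CI-LMIP satisfies $(\epsilon,\delta^{\mathrm{LDP}}_\mu(\epsilon))$-LDP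 for every $\epsilon>0$. This is tight. Let $A\subset\mathcal X$ be measurable with $A$ and its complement non-empty, and let $\epsilon>0$. Then there is a maximizing pair $(p_0,p_1)$ such that the mechanism with output in $\{0,1\}$ which draws from $\mathrm{Ber}(p_1)$ if $x\in A$ and from $\mathrm{Ber}(p_0)$ otherwise satisfies $\mu$-CI-LMIP, and satisfies $(\epsilon,\delta)$-LDP if and only if $\delta\ge\delta^{\mathrm{LDP}}_\mu(\epsilon)$. In particular, it does not satisfy $(\epsilon,\delta)$-LDP for any $\delta<\delta^{\mathrm{LDP}}_\mu(\epsilon)$. (b) Conversely, if $M$ satisfies $(\epsilon,\delta(\epsilon))$-LDP for all $\epsilon>0$, then, for every $\mathcal P$, $M$ satisfies $\mu$-CI-LMIP with $$\mu=\log(e)\int_0^\infty(1+e^{-\epsilon})\,\delta(\epsilon)\,d\epsilon\in[0,\infty].$$ -/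

import Mathlib

open MeasureTheory ProbabilityTheory InformationTheory unitInterval
open scoped ENNReal

namespace LocalPrivacy

noncomputable section

variable {X Y : Type*} [MeasurableSpace X] [MeasurableSpace Y]

/-- The mutual information `I(x; M(x))`, in bits, between an input `x ∼ P` and the output of the
mechanism `M` (a kernel, `M x` being the law of the output on input `x`): the Kullback-Leibler
divergence between the joint law and the product of its marginals. Mathlib's `klDiv` is in nats. -/
def mutualInfo (P : Measure X) (M : Kernel X Y) : ℝ≥0∞ :=
  klDiv (P ⊗ₘ M) (P.prod (M ∘ₘ P)) / ENNReal.ofReal (Real.log 2)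

/-- Context-independent local mutual-information privacy: the supremum of `I(x; M(x))` over the
space `𝓓` of data distributions is at most `μ` bits. -/
def IsCILMIP (𝓓 : Set (ProbabilityMeasure X)) (μ : ℝ≥0∞) (M : Kernel X Y) : Prop :=
  (⨆ P ∈ 𝓓, mutualInfo (P : Measure X) M) ≤ μ

/-- `(ε, δ)`-local differential privacy. -/
def IsLDP (ε δ : ℝ) (M : Kernel X Y) : Prop :=
  ∀ x x' : X, ∀ E : Set Y, MeasurableSet E →
    (M x).real E ≤ Real.exp ε * (M x').real E + δ

/-- The set of data distributions contains every distribution `t δ_x + (1 - t) δ_{x'}` carried by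
at most two data points. -/
def ContainsTwoPoint (𝓓 : Set (ProbabilityMeasure X)) : Prop :=
  ∀ (x x' : X) (t : I) (P : ProbabilityMeasure X),
    (P : Measure X) = bernoulliMeasure x x' t → P ∈ 𝓓

/-- The Bernoulli distribution with parameter `p` on `Bool`; `true` plays the role of `1`. -/
def ber (p : I) : Measure Bool := bernoulliMeasure true false p

/-- The binary asymmetric channel with crossover probabilities `ε₀` (input `0` is flipped) and
`ε₁` (input `1` is flipped). -/
def bac (ε₀ ε₁ : I) : Kernel Bool Bool :=
  Kernel.ofFunOfCountable fun b => if b then ber (σ ε₁) else ber ε₀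

/-- The capacity, in bits, of the binary asymmetric channel. -/
def bacCapacity (ε₀ ε₁ : I) : ℝ≥0∞ :=
  ⨆ P : ProbabilityMeasure Bool, mutualInfo (P : Measure Bool) (bac ε₀ ε₁)

/-- Binary entropy in bits. -/
def binEntropyBits (p : ℝ) : ℝ :=
  -p * Real.logb 2 p - (1 - p) * Real.logb 2 (1 - p)

/-- The closed form for the capacity of the binary asymmetric channel; meant for `a + b ≠ 1`. -/
def bacFormula (a b : ℝ) : ℝ :=
  a / (1 - a - b) * binEntropyBits b - (1 - b) / (1 - a - b) * binEntropyBits a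
    + Real.logb 2 (1 + 2 ^ ((binEntropyBits a - binEntropyBits b) / (1 - a - b)))

/-- The objective `max {0, p₀ - e^ε p₁, p₁ - e^ε p₀}`. -/
def ldpObjective (ε : ℝ) (p₀ p₁ : I) : ℝ :=
  max 0 (max ((p₀ : ℝ) - Real.exp ε * p₁) ((p₁ : ℝ) - Real.exp ε * p₀))

/-- The values of the objective over the pairs with `C_BAC(p₀, 1 - p₁) ≤ μ`. -/
def ldpValues (μ : ℝ≥0∞) (ε : ℝ) : Set ℝ :=
  {d | ∃ p₀ p₁ : I, bacCapacity p₀ (σ p₁) ≤ μ ∧ d = ldpObjective ε p₀ p₁}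

/-- `δ^LDP_μ(ε)`. -/
def deltaLDP (μ : ℝ≥0∞) (ε : ℝ) : ℝ := sSup (ldpValues μ ε)

open scoped Classical in
/-- The two-output mechanism with law `Ber(p₁)` on inputs in `A` and `Ber(p₀)` on the others. -/
def berMechanism {A : Set X} (hA : MeasurableSet A) (p₀ p₁ : I) :
    Kernel X Bool :=
  Kernel.piecewise hA (Kernel.const X (ber p₁)) (Kernel.const X (ber p₀))

/-- `log₂(e) ∫_0^∞ (1 + e^{-ε}) δ(ε) dε`, possibly infinite. -/
def muCI (δ : ℝ → ℝ) : ℝ≥0∞ :=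
  ENNReal.ofReal (Real.logb 2 (Real.exp 1)) *
    ∫⁻ ε in Set.Ioi (0 : ℝ), ENNReal.ofReal ((1 + Real.exp (-ε)) * δ ε)

end

end LocalPrivacy

/-! For (a), fix x, x' and an event E. Inputs supported on {x, x'} and the output bit 1_E turn M
into a binary channel with p₁ = M(x)(E) and p₀ = M(x')(E). By data processing
(`mutualInfo_quantize_le`) its information is at most μ for every input weight, hence so is its
capacity, and (p₀, p₁) competes in the maximum. Conversely, the information of a two-valued
mechanism depends on the input law only through the mass of `A` (`mutualInfo_berMechanism`), so it
never exceeds the capacity of its channel, and a maximizing pair gives an extremal mechanism. The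
maximum exists because capacity is a supremum of continuous functions: it is lower semicontinuous,
and the admissible pairs form a compact set.

For the closed form, the information is a constant plus H(q) + qc, where q is the probability of
output 1. Gibbs' inequality puts the maximum at log-odds c (`binEntropy_add_mul_le`), and
`le_logistic` and `logistic_le` show that some input weight reaches it.

For (b), the KL divergence is bounded by an integral over ε of hockey-stick divergences in both
directions, with weights 1 and e^{-ε} (`klDiv_le_lintegral`). LDP, averaged over the input, bounds
each of them by δ(ε) for the joint law against the product of its marginals. -/

namespace LocalPrivacy

/-! ### Mutual information of two-valued mechanisms with binary output -/

section BinaryOutput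

instance (p : I) : IsProbabilityMeasure (ber p) := by
  unfold ber; infer_instance

lemma lintegral_ber (p : I) (f : Bool → ℝ≥0∞) :
    ∫⁻ b, f b ∂ber p = ENNReal.ofReal p * f true + ENNReal.ofReal (1 - p) * f false := by
  have h (r : I) : ((toNNReal r : NNReal) : ℝ≥0∞) = ENNReal.ofReal r := by
    rw [ENNReal.ofReal, Real.toNNReal_of_nonneg r.2.1]; rfl
  rw [ber, bernoulliMeasure_def, lintegral_add_measure]
  simp only [lintegral_smul_measure, lintegral_dirac]
  simp only [ENNReal.smul_def, h, smul_eq_mul, coe_symm_eq]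

lemma ber_apply (p : I) (s : Set Bool) :
    ber p s = ENNReal.ofReal p * s.indicator 1 true
      + ENNReal.ofReal (1 - p) * s.indicator 1 false := by
  rw [← lintegral_ber, lintegral_indicator_one (MeasurableSet.of_discrete)]

variable {X : Type*} [MeasurableSpace X] {A : Set X}

instance (hA : MeasurableSet A) (p₀ p₁ : I) : IsMarkovKernel (berMechanism hA p₀ p₁) := by
  unfold berMechanism; infer_instance

lemma berMechanism_apply_of_mem (hA : MeasurableSet A) (p₀ p₁ : I) {x : X} (hx : x ∈ A) :
    berMechanism hA p₀ p₁ x = ber p₁ := by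
  simp [berMechanism, Kernel.piecewise_apply, hx]

lemma berMechanism_apply_of_notMem (hA : MeasurableSet A) (p₀ p₁ : I) {x : X} (hx : x ∉ A) :
    berMechanism hA p₀ p₁ x = ber p₀ := by
  simp [berMechanism, Kernel.piecewise_apply, hx]

/-- The mixture `t p₁ + (1 - t) p₀` of two probabilities. -/
noncomputable def mix (t p₀ p₁ : I) : I :=
  ⟨t * p₁ + (1 - t) * p₀, by
    have := t.2.1; have := t.2.2; have := p₀.2.1; have := p₁.2.1
    have := sub_nonneg.2 t.2.2
    positivity, by
    nlinarith [t.2.1, t.2.2, p₀.2.2, p₁.2.2]⟩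

/-- The mutual information, in nats, between the input and the output of a channel with binary
input and output: the input is `1` with probability `t`, and the output is then `1` with probability
`p₁`, otherwise it is `1` with probability `p₀`. -/
noncomputable def binaryInfo (t p₀ p₁ : ℝ) : ℝ :=
  Real.binEntropy (t * p₁ + (1 - t) * p₀) - t * Real.binEntropy p₁ - (1 - t) * Real.binEntropy p₀

lemma lintegral_of_two_values (P : Measure X) [IsProbabilityMeasure P] (hA : MeasurableSet A)
    {f : X → ℝ≥0∞} {a b : ℝ≥0∞} (ha : ∀ x ∈ A, f x = a) (hb : ∀ x ∉ A, f x = b) :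
    ∫⁻ x, f x ∂P = ENNReal.ofReal (P.real A) * a + ENNReal.ofReal (1 - P.real A) * b := by
  rw [← lintegral_add_compl f hA, setLIntegral_congr_fun hA ha,
    setLIntegral_congr_fun hA.compl (fun x hx => hb x hx), setLIntegral_const, setLIntegral_const,
    ← probReal_compl_eq_one_sub hA, ofReal_measureReal, ofReal_measureReal, mul_comm a, mul_comm b]

lemma comp_berMechanism (P : Measure X) [IsProbabilityMeasure P] (hA : MeasurableSet A)
    (p₀ p₁ : I) :
    berMechanism hA p₀ p₁ ∘ₘ P =
      ber (mix ⟨P.real A, measureReal_nonneg, measureReal_le_one⟩ p₀ p₁) := by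
  ext s hs
  have h1 := sub_nonneg.2 (measureReal_le_one (μ := P) (s := A))
  have h0 := measureReal_nonneg (μ := P) (s := A)
  rw [Measure.bind_apply hs (Kernel.aemeasurable _),
    lintegral_of_two_values P hA (a := ber p₁ s) (b := ber p₀ s)
      (fun x hx => by rw [berMechanism_apply_of_mem hA _ _ hx])
      (fun x hx => by rw [berMechanism_apply_of_notMem hA _ _ hx]),
    ber_apply, ber_apply, ber_apply]
  have hp := p₀.2.1
  have hp' := sub_nonneg.2 p₀.2.2
  have hq := p₁.2.1
  have hq' := sub_nonneg.2 p₁.2.2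
  simp only [mix, mul_add, ← mul_assoc]
  rw [ENNReal.ofReal_add (by positivity) (by positivity),
    show (1 - (P.real A * p₁ + (1 - P.real A) * p₀) : ℝ)
      = P.real A * (1 - p₁) + (1 - P.real A) * (1 - p₀) by ring,
    ENNReal.ofReal_add (by positivity) (by positivity)]
  simp only [ENNReal.ofReal_mul h0, ENNReal.ofReal_mul h1]
  ring

/-- The hypothesis is absolute continuity, so the default values of division and `log` at 0 do no
harm. The correction q - p cancels when the two outcomes are summed. -/
lemma mul_klFun_div {p q : ℝ} (h : q = 0 → p = 0) :
    q * klFun (p / q) = -Real.negMulLog p - p * Real.log q + q - p := by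
  by_cases hq : q = 0
  · simp [hq, h hq]
  by_cases hp : p = 0
  · simp [hp, klFun_apply]
  rw [klFun_apply, Real.log_div hp hq, Real.negMulLog]
  field_simp

/-- The density of a Bernoulli distribution with parameter `p` with respect to one with
parameter `q`. -/
noncomputable def berDensity (p q : ℝ) (b : Bool) : ℝ :=
  if b then p / q else (1 - p) / (1 - q)

lemma berDensity_nonneg (p q : I) (b : Bool) : 0 ≤ berDensity p q b := by
  have hp := p.2.1
  have hp' := sub_nonneg.2 p.2.2
  have hq := q.2.1
  have hq' := sub_nonneg.2 q.2.2
  cases b <;> simp only [berDensity] <;> positivity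

lemma mul_berDensity_true {p q : ℝ} (hq : 0 ≤ q) (h : q = 0 → p = 0) :
    ENNReal.ofReal q * ENNReal.ofReal (berDensity p q true) = ENNReal.ofReal p := by
  rw [← ENNReal.ofReal_mul hq, berDensity, if_pos rfl, mul_div_cancel_of_imp' h]

lemma mul_berDensity_false {p q : ℝ} (hq : q ≤ 1) (h : q = 1 → p = 1) :
    ENNReal.ofReal (1 - q) * ENNReal.ofReal (berDensity p q false) = ENNReal.ofReal (1 - p) := by
  rw [← ENNReal.ofReal_mul (sub_nonneg.2 hq), berDensity, if_neg (by simp),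
    mul_div_cancel_of_imp']
  intro h'
  rw [h (by linarith), sub_self]

/-- This and the next three lemmas say that a mixture dominates each component of non-zero weight.
-/
lemma eq_zero_of_mix_eq_zero_left {t p₀ p₁ : I} (ht : (t : ℝ) ≠ 0) (h : (mix t p₀ p₁ : ℝ) = 0) :
    (p₁ : ℝ) = 0 := by
  have h1 := mul_nonneg t.2.1 p₁.2.1
  have h2 := mul_nonneg (sub_nonneg.2 t.2.2) p₀.2.1
  simp only [mix] at h
  exact (mul_eq_zero.1 (by linarith : (t : ℝ) * p₁ = 0)).resolve_left ht

lemma eq_one_of_mix_eq_one_left {t p₀ p₁ : I} (ht : (t : ℝ) ≠ 0) (h : (mix t p₀ p₁ : ℝ) = 1) :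
    (p₁ : ℝ) = 1 := by
  have h1 := mul_nonneg t.2.1 (sub_nonneg.2 p₁.2.2)
  have h2 := mul_nonneg (sub_nonneg.2 t.2.2) (sub_nonneg.2 p₀.2.2)
  simp only [mix] at h
  have := (mul_eq_zero.1 (by linarith : (t : ℝ) * (1 - p₁) = 0)).resolve_left ht
  linarith

lemma eq_zero_of_mix_eq_zero_right {t p₀ p₁ : I} (ht : 1 - (t : ℝ) ≠ 0)
    (h : (mix t p₀ p₁ : ℝ) = 0) : (p₀ : ℝ) = 0 := by
  have h1 := mul_nonneg t.2.1 p₁.2.1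
  have h2 := mul_nonneg (sub_nonneg.2 t.2.2) p₀.2.1
  simp only [mix] at h
  exact (mul_eq_zero.1 (by linarith : (1 - t : ℝ) * p₀ = 0)).resolve_left ht

lemma eq_one_of_mix_eq_one_right {t p₀ p₁ : I} (ht : 1 - (t : ℝ) ≠ 0)
    (h : (mix t p₀ p₁ : ℝ) = 1) : (p₀ : ℝ) = 1 := by
  have h1 := mul_nonneg t.2.1 (sub_nonneg.2 p₁.2.2)
  have h2 := mul_nonneg (sub_nonneg.2 t.2.2) (sub_nonneg.2 p₀.2.2)
  simp only [mix] at h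
  have := (mul_eq_zero.1 (by linarith : (1 - t : ℝ) * (1 - p₀) = 0)).resolve_left ht
  linarith

lemma ae_mem_imp_measureReal_ne_zero (P : Measure X) [IsProbabilityMeasure P] (A : Set X) :
    ∀ᵐ x ∂P, x ∈ A → P.real A ≠ 0 := by
  by_cases h : P A = 0
  · filter_upwards [measure_eq_zero_iff_ae_notMem.1 h] with x hx hx'
    exact absurd hx' hx
  · exact Filter.Eventually.of_forall fun x _ => by simpa [measureReal_eq_zero_iff] using h

open scoped Classical in
/-- The density of the joint law of the input and the output of `berMechanism` with respect to the
product of its marginals. -/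
noncomputable def jointDensity (A : Set X) (t p₀ p₁ : I) (z : X × Bool) : ℝ :=
  berDensity (if z.1 ∈ A then p₁ else p₀ : I) (mix t p₀ p₁) z.2

lemma measurable_jointDensity (hA : MeasurableSet A) (t p₀ p₁ : I) :
    Measurable (jointDensity A t p₀ p₁) := by
  classical
  refine measurable_from_prod_countable_left fun b => ?_
  have h (x : X) : jointDensity A t p₀ p₁ (x, b) =
      if x ∈ A then berDensity p₁ (mix t p₀ p₁) b else berDensity p₀ (mix t p₀ p₁) b := by
    simp only [jointDensity]
    split_ifs <;> rfl
  simp only [h]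
  exact Measurable.ite hA measurable_const measurable_const

lemma compProd_berMechanism (P : Measure X) [IsProbabilityMeasure P] (hA : MeasurableSet A)
    (p₀ p₁ : I) :
    P ⊗ₘ berMechanism hA p₀ p₁ = (P.prod (berMechanism hA p₀ p₁ ∘ₘ P)).withDensity
      fun z => ENNReal.ofReal
        (jointDensity A ⟨P.real A, measureReal_nonneg, measureReal_le_one⟩ p₀ p₁ z) := by
  rw [comp_berMechanism]
  set t : I := ⟨P.real A, measureReal_nonneg, measureReal_le_one⟩ with ht
  ext s hs
  have hm : Measurable fun z => ENNReal.ofReal (jointDensity A t p₀ p₁ z) :=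
    (measurable_jointDensity hA t p₀ p₁).ennreal_ofReal
  rw [Measure.compProd_apply hs, withDensity_apply _ hs, ← lintegral_indicator hs,
    lintegral_prod _ (hm.indicator hs).aemeasurable]
  refine lintegral_congr_ae ?_
  -- Domination by the mixture can fail only on a side of zero weight, and almost no x lies there.
  filter_upwards [ae_mem_imp_measureReal_ne_zero P A, ae_mem_imp_measureReal_ne_zero P Aᶜ]
    with x h1 h2
  have hind (b : Bool) : s.indicator (fun z => ENNReal.ofReal (jointDensity A t p₀ p₁ z)) (x, b)
      = ENNReal.ofReal (jointDensity A t p₀ p₁ (x, b))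
        * (Prod.mk x ⁻¹' s).indicator 1 b := by
    by_cases h : (x, b) ∈ s <;> simp [h]
  rw [lintegral_ber, hind, hind, ← mul_assoc, ← mul_assoc]
  by_cases hx : x ∈ A
  · rw [berMechanism_apply_of_mem hA _ _ hx, ber_apply]
    simp only [jointDensity, if_pos hx]
    rw [mul_berDensity_true (mix t p₀ p₁).2.1 (eq_zero_of_mix_eq_zero_left (h1 hx)),
      mul_berDensity_false (mix t p₀ p₁).2.2 (eq_one_of_mix_eq_one_left (h1 hx))]
  · rw [berMechanism_apply_of_notMem hA _ _ hx, ber_apply]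
    have h3 : 1 - (t : ℝ) ≠ 0 := by
      have := h2 hx
      rwa [probReal_compl_eq_one_sub hA] at this
    simp only [jointDensity, if_neg hx]
    rw [mul_berDensity_true (mix t p₀ p₁).2.1 (eq_zero_of_mix_eq_zero_right h3),
      mul_berDensity_false (mix t p₀ p₁).2.2 (eq_one_of_mix_eq_one_right h3)]

lemma mul_klFun_berDensity {p q : ℝ} (h0 : q = 0 → p = 0) (h1 : q = 1 → p = 1) :
    q * klFun (berDensity p q true) + (1 - q) * klFun (berDensity p q false)
      = -Real.binEntropy p - p * Real.log q - (1 - p) * Real.log (1 - q) := by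
  have h1' : 1 - q = 0 → 1 - p = 0 := fun h => by rw [h1 (by linarith), sub_self]
  simp only [berDensity, if_true, Bool.false_eq_true, if_false]
  rw [mul_klFun_div h0, mul_klFun_div h1',
    Real.binEntropy_eq_negMulLog_add_negMulLog_one_sub]
  ring

/-- The mutual information of a mechanism that takes two values, in closed form. -/
lemma mutualInfo_berMechanism (P : Measure X) [IsProbabilityMeasure P] (hA : MeasurableSet A)
    (p₀ p₁ : I) :
    mutualInfo P (berMechanism hA p₀ p₁) =
      ENNReal.ofReal (binaryInfo (P.real A) p₀ p₁) / ENNReal.ofReal (Real.log 2) := by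
  rw [mutualInfo]
  congr 1
  have hden := compProd_berMechanism P hA p₀ p₁
  set t : I := ⟨P.real A, measureReal_nonneg, measureReal_le_one⟩ with ht
  have hm : Measurable fun z => ENNReal.ofReal (jointDensity A t p₀ p₁ z) :=
    (measurable_jointDensity hA t p₀ p₁).ennreal_ofReal
  rw [klDiv_eq_lintegral_klFun_of_ac (by rw [hden]; exact withDensity_absolutelyContinuous _ _)]
  have hrn := Measure.rnDeriv_withDensity (P.prod (berMechanism hA p₀ p₁ ∘ₘ P)) hm
  rw [← hden] at hrn
  have hnn (z : X × Bool) : 0 ≤ jointDensity A t p₀ p₁ z := berDensity_nonneg _ _ _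
  rw [lintegral_congr_ae (g := fun z => ENNReal.ofReal (klFun (jointDensity A t p₀ p₁ z))) (by
      filter_upwards [hrn] with z hz
      rw [hz, ENNReal.toReal_ofReal (hnn z)]),
    lintegral_prod _ (by
      have := measurable_jointDensity hA t p₀ p₁
      fun_prop), comp_berMechanism]
  have hq0 := (mix t p₀ p₁).2.1
  have hq1 := sub_nonneg.2 (mix t p₀ p₁).2.2
  have hval (p : I) : 0 ≤ (mix t p₀ p₁ : ℝ) * klFun (berDensity p (mix t p₀ p₁) true) +
      (1 - (mix t p₀ p₁ : ℝ)) * klFun (berDensity p (mix t p₀ p₁) false) :=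
    add_nonneg (mul_nonneg hq0 (klFun_nonneg (berDensity_nonneg _ _ _)))
      (mul_nonneg hq1 (klFun_nonneg (berDensity_nonneg _ _ _)))
  have hfib (p : I) : ENNReal.ofReal (mix t p₀ p₁) *
        ENNReal.ofReal (klFun (berDensity p (mix t p₀ p₁) true)) +
      ENNReal.ofReal (1 - mix t p₀ p₁) *
        ENNReal.ofReal (klFun (berDensity p (mix t p₀ p₁) false)) =
      ENNReal.ofReal (mix t p₀ p₁ * klFun (berDensity p (mix t p₀ p₁) true) +
        (1 - mix t p₀ p₁) * klFun (berDensity p (mix t p₀ p₁) false)) := by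
    rw [← ENNReal.ofReal_mul hq0, ← ENNReal.ofReal_mul hq1, ENNReal.ofReal_add
      (mul_nonneg hq0 (klFun_nonneg (berDensity_nonneg _ _ _)))
      (mul_nonneg hq1 (klFun_nonneg (berDensity_nonneg _ _ _)))]
  rw [lintegral_of_two_values P hA
    (fun x hx => by simp only [lintegral_ber, jointDensity, if_pos hx]; exact hfib p₁)
    (fun x hx => by simp only [lintegral_ber, jointDensity, if_neg hx]; exact hfib p₀)]
  have ht0 : 0 ≤ P.real A := t.2.1
  have ht1 : 0 ≤ 1 - P.real A := sub_nonneg.2 t.2.2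
  change ENNReal.ofReal t * ENNReal.ofReal _ + ENNReal.ofReal (1 - t) * ENNReal.ofReal _
    = ENNReal.ofReal (binaryInfo t p₀ p₁)
  rw [← ENNReal.ofReal_mul ht0, ← ENNReal.ofReal_mul ht1, ← ENNReal.ofReal_add
    (mul_nonneg ht0 (hval _)) (mul_nonneg ht1 (hval _))]
  congr 1
  -- The factor t stays in the identity: if it vanishes, `p₁` need not be dominated, but the term is
  -- 0.
  have e1 : (t : ℝ) * (mix t p₀ p₁ * klFun (berDensity p₁ (mix t p₀ p₁) true) +
      (1 - mix t p₀ p₁) * klFun (berDensity p₁ (mix t p₀ p₁) false)) = t *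
      (-Real.binEntropy p₁ - p₁ * Real.log (mix t p₀ p₁)
        - (1 - p₁) * Real.log (1 - mix t p₀ p₁)) := by
    by_cases h : (t : ℝ) = 0
    · simp [h]
    · rw [mul_klFun_berDensity (eq_zero_of_mix_eq_zero_left h) (eq_one_of_mix_eq_one_left h)]
  have e0 : (1 - t : ℝ) * (mix t p₀ p₁ * klFun (berDensity p₀ (mix t p₀ p₁) true) +
      (1 - mix t p₀ p₁) * klFun (berDensity p₀ (mix t p₀ p₁) false)) = (1 - t) *
      (-Real.binEntropy p₀ - p₀ * Real.log (mix t p₀ p₁)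
        - (1 - p₀) * Real.log (1 - mix t p₀ p₁)) := by
    by_cases h : (1 - t : ℝ) = 0
    · simp [h]
    · rw [mul_klFun_berDensity (eq_zero_of_mix_eq_zero_right h) (eq_one_of_mix_eq_one_right h)]
  rw [e1, e0, binaryInfo]
  change _ = Real.binEntropy (mix t p₀ p₁) - _ - _
  rw [Real.binEntropy_eq_negMulLog_add_negMulLog_one_sub (mix t p₀ p₁), Real.negMulLog,
    Real.negMulLog]
  have hmix : (mix t p₀ p₁ : ℝ) = t * p₁ + (1 - t) * p₀ := rfl
  generalize Real.log (mix t p₀ p₁) = L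
  generalize Real.log (1 - mix t p₀ p₁) = L'
  rw [hmix]
  ring

end BinaryOutput

/-! ### Capacity as a supremum over the input weight, and its symmetries -/

section Capacity

lemma bac_eq_berMechanism (a b : I) :
    bac a b = berMechanism (MeasurableSet.of_discrete (s := {true})) a (σ b) := by
  ext1 x
  cases x
  · rw [berMechanism_apply_of_notMem _ _ _ (by simp)]
    rfl
  · rw [berMechanism_apply_of_mem _ _ _ (by simp)]
    rfl

instance (a b : I) : IsMarkovKernel (bac a b) := by
  rw [bac_eq_berMechanism]; infer_instance

lemma bacCapacity_eq_iSup (a b : I) :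
    bacCapacity a b = ⨆ t : I, ENNReal.ofReal (binaryInfo t a (1 - b))
      / ENNReal.ofReal (Real.log 2) := by
  simp only [bacCapacity, bac_eq_berMechanism]
  apply le_antisymm
  · refine iSup_le fun P => ?_
    rw [mutualInfo_berMechanism]
    exact le_iSup (fun t : I => ENNReal.ofReal (binaryInfo t a (1 - b))
      / ENNReal.ofReal (Real.log 2)) ⟨_, measureReal_nonneg, measureReal_le_one⟩
  · refine iSup_le fun t => ?_
    refine le_iSup_of_le ⟨ber t, inferInstance⟩ ?_
    rw [ProbabilityMeasure.coe_mk, mutualInfo_berMechanism]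
    simp [ber]

lemma mutualInfo_berMechanism_le {X : Type*} [MeasurableSpace X] {A : Set X} (P : Measure X)
    [IsProbabilityMeasure P] (hA : MeasurableSet A) (p₀ p₁ : I) :
    mutualInfo P (berMechanism hA p₀ p₁) ≤ bacCapacity p₀ (σ p₁) := by
  rw [mutualInfo_berMechanism, bacCapacity_eq_iSup]
  simp only [coe_symm_eq, sub_sub_cancel]
  exact le_iSup (fun t : I => ENNReal.ofReal (binaryInfo t p₀ p₁)
      / ENNReal.ofReal (Real.log 2)) ⟨_, measureReal_nonneg, measureReal_le_one⟩

lemma binaryInfo_swap (t p₀ p₁ : ℝ) : binaryInfo (1 - t) p₀ p₁ = binaryInfo t p₁ p₀ := by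
  simp only [binaryInfo, sub_sub_cancel]
  rw [add_comm]
  ring

lemma binaryInfo_one_sub (t p₀ p₁ : ℝ) :
    binaryInfo t (1 - p₀) (1 - p₁) = binaryInfo t p₀ p₁ := by
  simp only [binaryInfo, Real.binEntropy_one_sub]
  rw [← Real.binEntropy_one_sub]
  congr 3
  ring

lemma bacCapacity_symm_symm (a b : I) : bacCapacity (σ a) (σ b) = bacCapacity a b := by
  simp only [bacCapacity_eq_iSup, coe_symm_eq, binaryInfo_one_sub]

lemma bacCapacity_swap (a b : I) : bacCapacity a b = bacCapacity b a := by
  simp only [bacCapacity_eq_iSup]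
  refine Equiv.iSup_congr symmHomeomorph.toEquiv fun t => ?_
  rw [show ((symmHomeomorph.toEquiv t : I) : ℝ) = 1 - t from rfl, binaryInfo_swap,
    ← binaryInfo_one_sub]
  simp

lemma bacCapacity_eq_zero {a b : I} (h : (a : ℝ) + b = 1) : bacCapacity a b = 0 := by
  rw [bacCapacity_eq_iSup]
  simp only [ENNReal.iSup_eq_zero]
  intro t
  rw [show (1 - b : ℝ) = a by linarith, show binaryInfo t a a = 0 by
    simp only [binaryInfo]; rw [show (t * a + (1 - t) * a : ℝ) = a by ring]; ring]
  simp

lemma lowerSemicontinuous_bacCapacity :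
    LowerSemicontinuous fun p : I × I => bacCapacity p.1 (σ p.2) := by
  simp only [bacCapacity_eq_iSup, coe_symm_eq, sub_sub_cancel]
  refine lowerSemicontinuous_iSup fun t => Continuous.lowerSemicontinuous ?_
  refine (ENNReal.continuous_div_const _ (by simp [Real.log_pos])).comp
    (ENNReal.continuous_ofReal.comp ?_)
  unfold binaryInfo
  fun_prop

end Capacity


/-! ### Closed form of the capacity -/

section ClosedForm

lemma binEntropyBits_eq (p : ℝ) : binEntropyBits p = Real.binEntropy p / Real.log 2 := by
  rw [binEntropyBits, Real.binEntropy_eq_negMulLog_add_negMulLog_one_sub, Real.negMulLog,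
    Real.negMulLog, Real.logb, Real.logb]
  ring

/-- Gibbs' inequality for two Bernoulli distributions. -/
lemma binEntropy_le_cross {p q : ℝ} (hp0 : 0 ≤ p) (hp1 : p ≤ 1) (hq0 : 0 < q) (hq1 : q < 1) :
    Real.binEntropy p ≤ -p * Real.log q - (1 - p) * Real.log (1 - q) := by
  have h1 := klFun_nonneg (div_nonneg hp0 hq0.le)
  have h2 := klFun_nonneg (div_nonneg (sub_nonneg.2 hp1) (sub_nonneg.2 hq1.le))
  have e1 := mul_klFun_div (p := p) (q := q) (fun h => absurd h hq0.ne')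
  have e2 := mul_klFun_div (p := 1 - p) (q := 1 - q) (fun h => absurd h (sub_pos.2 hq1).ne')
  rw [Real.binEntropy_eq_negMulLog_add_negMulLog_one_sub]
  nlinarith [mul_nonneg hq0.le h1, mul_nonneg (sub_nonneg.2 hq1.le) h2]

lemma log_logistic (c : ℝ) :
    Real.log (Real.exp c / (1 + Real.exp c)) = c - Real.log (1 + Real.exp c) := by
  rw [Real.log_div (by positivity) (by positivity), Real.log_exp]

lemma log_one_sub_logistic (c : ℝ) :
    Real.log (1 - Real.exp c / (1 + Real.exp c)) = -Real.log (1 + Real.exp c) := by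
  rw [← Real.log_inv]
  congr 1
  field_simp
  ring

lemma logistic_pos (c : ℝ) : 0 < Real.exp c / (1 + Real.exp c) := by positivity

lemma logistic_lt_one (c : ℝ) : Real.exp c / (1 + Real.exp c) < 1 := by
  rw [div_lt_one (by positivity)]; linarith

/-- Gibbs' inequality against the Bernoulli law with log-odds c, whose cross entropy is affine in q
with slope -c. `binEntropy_logistic` is the equality case. -/
lemma binEntropy_add_mul_le {q : ℝ} (h0 : 0 ≤ q) (h1 : q ≤ 1) (c : ℝ) :
    Real.binEntropy q + q * c ≤ Real.log (1 + Real.exp c) := by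
  have := binEntropy_le_cross h0 h1 (logistic_pos c) (logistic_lt_one c)
  rw [log_logistic, log_one_sub_logistic] at this
  linarith

lemma binEntropy_logistic (c : ℝ) :
    Real.binEntropy (Real.exp c / (1 + Real.exp c)) + Real.exp c / (1 + Real.exp c) * c
      = Real.log (1 + Real.exp c) := by
  rw [Real.binEntropy_eq_negMulLog_add_negMulLog_one_sub, Real.negMulLog, Real.negMulLog,
    log_logistic, log_one_sub_logistic]
  ring

/-- The capacity of the binary asymmetric channel in nats, for `a + b < 1`. -/
noncomputable def bacNats (a b : ℝ) : ℝ :=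
  a / (1 - a - b) * Real.binEntropy b - (1 - b) / (1 - a - b) * Real.binEntropy a
    + Real.log (1 + Real.exp ((Real.binEntropy a - Real.binEntropy b) / (1 - a - b)))

lemma bacFormula_eq (a b : ℝ) : bacFormula a b = bacNats a b / Real.log 2 := by
  have hl : Real.log 2 ≠ 0 := (Real.log_pos one_lt_two).ne'
  rw [bacFormula, bacNats, binEntropyBits_eq, binEntropyBits_eq, Real.logb,
    Real.rpow_def_of_pos two_pos, show Real.log 2 * ((Real.binEntropy a / Real.log 2 -
      Real.binEntropy b / Real.log 2) / (1 - a - b))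
      = (Real.binEntropy a - Real.binEntropy b) / (1 - a - b) by field_simp]
  ring

/-- The conditional entropy is affine in t, hence in the output probability q = a + t(1 - a - b),
with slope -c in q. -/
lemma binaryInfo_eq {a b t : ℝ} (hs : 1 - a - b ≠ 0) :
    binaryInfo t a (1 - b) = a / (1 - a - b) * Real.binEntropy b
      - (1 - b) / (1 - a - b) * Real.binEntropy a
      + (Real.binEntropy (a + t * (1 - a - b)) + (a + t * (1 - a - b)) *
        ((Real.binEntropy a - Real.binEntropy b) / (1 - a - b))) := by
  rw [binaryInfo, Real.binEntropy_one_sub,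
    show t * (1 - b) + (1 - t) * a = a + t * (1 - a - b) by ring]
  generalize Real.binEntropy (a + t * (1 - a - b)) = H
  field_simp
  ring

/-- The optimal output distribution of the channel puts at least the mass `a` on `1`. -/
lemma le_logistic {a b : ℝ} (ha : 0 ≤ a) (hb : 0 ≤ b) (hs : a + b < 1) :
    a ≤ Real.exp ((Real.binEntropy a - Real.binEntropy b) / (1 - a - b)) /
      (1 + Real.exp ((Real.binEntropy a - Real.binEntropy b) / (1 - a - b))) := by
  set c := (Real.binEntropy a - Real.binEntropy b) / (1 - a - b) with hc
  rcases ha.eq_or_lt with rfl | ha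
  · exact (logistic_pos c).le
  -- Gibbs for the output law given input 1 against the one given input 0; it says that the log-odds
  -- of a are at most c.
  have h := binEntropy_le_cross (p := 1 - b) (q := a) (by linarith) (by linarith) ha (by linarith)
  rw [Real.binEntropy_one_sub] at h
  have h2 : Real.log a - Real.log (1 - a) ≤ c := by
    rw [hc, le_div_iff₀ (by linarith), Real.binEntropy_eq_negMulLog_add_negMulLog_one_sub a,
      Real.negMulLog, Real.negMulLog]
    linarith
  rw [← Real.log_div ha.ne' (by linarith), Real.log_le_iff_le_exp (div_pos ha (by linarith)),
    div_le_iff₀ (by linarith)] at h2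
  rw [le_div_iff₀ (by positivity)]
  linarith

lemma logistic_neg (c : ℝ) :
    Real.exp (-c) / (1 + Real.exp (-c)) = 1 - Real.exp c / (1 + Real.exp c) := by
  rw [Real.exp_neg]
  field_simp
  ring

lemma logistic_le {a b : ℝ} (ha : 0 ≤ a) (hb : 0 ≤ b) (hs : a + b < 1) :
    Real.exp ((Real.binEntropy a - Real.binEntropy b) / (1 - a - b)) /
      (1 + Real.exp ((Real.binEntropy a - Real.binEntropy b) / (1 - a - b))) ≤ 1 - b := by
  have h := le_logistic hb ha (by linarith : b + a < 1)
  rw [show (Real.binEntropy b - Real.binEntropy a) / (1 - b - a)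
    = -((Real.binEntropy a - Real.binEntropy b) / (1 - a - b)) by
      rw [← neg_div, neg_sub]; congr 1; ring, logistic_neg] at h
  linarith

lemma bacCapacity_eq_bacNats {a b : I} (hs : (a : ℝ) + b < 1) :
    bacCapacity a b = ENNReal.ofReal (bacNats a b) / ENNReal.ofReal (Real.log 2) := by
  have hs' : 0 < 1 - (a : ℝ) - b := by linarith
  rw [bacCapacity_eq_iSup]
  apply le_antisymm
  · refine iSup_le fun t => ?_
    gcongr
    rw [binaryInfo_eq hs'.ne', bacNats]
    gcongr
    have h1 := mul_nonneg t.2.1 hs'.le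
    have h2 := mul_nonneg (sub_nonneg.2 t.2.2) hs'.le
    exact binEntropy_add_mul_le (by linarith [a.2.1]) (by nlinarith [b.2.1]) _
  · have h1 := le_logistic a.2.1 b.2.1 hs
    have h2 := logistic_le a.2.1 b.2.1 hs
    have h3 := binEntropy_logistic
      ((Real.binEntropy a - Real.binEntropy b) / (1 - a - b))
    set c := (Real.binEntropy a - Real.binEntropy b) / (1 - a - b : ℝ) with hc
    set q := Real.exp c / (1 + Real.exp c) with hq
    -- The input weight that makes the output probability equal to the optimal q.
    refine le_iSup_of_le ⟨(q - a) / (1 - a - b), div_nonneg (by linarith) hs'.le,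
      (div_le_one hs').2 (by linarith)⟩ (le_of_eq ?_)
    rw [binaryInfo_eq hs'.ne', bacNats, ← hc, ← h3]
    simp only [div_mul_cancel₀ _ hs'.ne', add_sub_cancel]

/-- At t = 0 the information vanishes, and `bacNats` bounds it from above. This keeps
`ENNReal.ofReal` from truncating. -/
lemma bacNats_nonneg {a b : ℝ} (ha : 0 ≤ a) (hb : 0 ≤ b) (hs : a + b < 1) : 0 ≤ bacNats a b := by
  have hs' : 0 < 1 - (a : ℝ) - b := by linarith
  have h := binaryInfo_eq (t := 0) hs'.ne'
  have h2 := binEntropy_add_mul_le ha (by linarith)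
    ((Real.binEntropy a - Real.binEntropy b) / (1 - a - b))
  simp only [binaryInfo, zero_mul, sub_zero, one_mul, zero_add, sub_self, add_zero] at h
  rw [bacNats]
  linarith

lemma bacCapacity_closedForm {a b : I} (hs : (a : ℝ) + b < 1) :
    bacCapacity a b ≠ ∞ ∧ (bacCapacity a b).toReal = bacFormula a b := by
  have hl : 0 < Real.log 2 := Real.log_pos one_lt_two
  rw [bacCapacity_eq_bacNats hs, ← ENNReal.ofReal_div_of_pos hl, bacFormula_eq]
  exact ⟨ENNReal.ofReal_ne_top,
    ENNReal.toReal_ofReal (div_nonneg (bacNats_nonneg a.2.1 b.2.1 hs) hl.le)⟩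

end ClosedForm

/-! ### The maximum defining δ and the extremal mechanism -/

section Extremal

lemma isGreatest_deltaLDP (μ : ℝ≥0∞) (ε : ℝ) : IsGreatest (ldpValues μ ε) (deltaLDP μ ε) := by
  have hK : IsCompact {p : I × I | bacCapacity p.1 (σ p.2) ≤ μ} :=
    (lowerSemicontinuous_bacCapacity.isClosed_preimage μ).isCompact
  have hV : ldpValues μ ε = (fun p : I × I => ldpObjective ε p.1 p.2) ''
      {p : I × I | bacCapacity p.1 (σ p.2) ≤ μ} := by
    ext d
    simp only [ldpValues, Set.mem_ofPred_eq, Set.mem_image, Prod.exists]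
    exact ⟨fun ⟨p, q, h, e⟩ => ⟨p, q, h, e.symm⟩, fun ⟨p, q, h, e⟩ => ⟨p, q, h, e.symm⟩⟩
  have hne : {p : I × I | bacCapacity p.1 (σ p.2) ≤ μ}.Nonempty :=
    ⟨(0, 0), (bacCapacity_eq_zero (by simp)).trans_le zero_le⟩
  rw [deltaLDP, hV]
  refine IsCompact.isGreatest_sSup (hK.image ?_) (hne.image _)
  unfold ldpObjective
  fun_prop

lemma ldpObjective_le_deltaLDP {μ : ℝ≥0∞} {p₀ p₁ : I} (h : bacCapacity p₀ (σ p₁) ≤ μ) (ε : ℝ) :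
    ldpObjective ε p₀ p₁ ≤ deltaLDP μ ε :=
  (isGreatest_deltaLDP μ ε).2 ⟨p₀, p₁, h, rfl⟩

lemma ber_real (p : I) (s : Set Bool) :
    (ber p).real s = p * s.indicator 1 true + (1 - p) * s.indicator 1 false := by
  have hp := p.2.1
  have hp' := sub_nonneg.2 p.2.2
  rw [measureReal_def, ber_apply]
  by_cases h1 : true ∈ s <;> by_cases h0 : false ∈ s <;>
    simp [h1, h0, hp, hp', ENNReal.toReal_add]

lemma ber_real_le {ε δ : ℝ} (hε : 0 ≤ ε) {p q : I} (h0 : 0 ≤ δ) (h1 : p - Real.exp ε * q ≤ δ)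
    (h2 : (1 - p) - Real.exp ε * (1 - q) ≤ δ) (s : Set Bool) :
    (ber p).real s ≤ Real.exp ε * (ber q).real s + δ := by
  have := Real.one_le_exp hε
  rw [ber_real, ber_real]
  by_cases h1 : true ∈ s <;> by_cases h0 : false ∈ s <;> simp [h1, h0] <;> linarith

lemma isLDP_berMechanism_iff {X : Type*} [MeasurableSpace X] {A : Set X} (hA : MeasurableSet A)
    (hA1 : A.Nonempty) (hA0 : Aᶜ.Nonempty) {μ : ℝ≥0∞} {ε : ℝ} (hε : 0 ≤ ε) {p₀ p₁ : I}
    (hp : bacCapacity p₀ (σ p₁) ≤ μ) (hmax : ldpObjective ε p₀ p₁ = deltaLDP μ ε) (δ : ℝ) :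
    IsLDP ε δ (berMechanism hA p₀ p₁) ↔ deltaLDP μ ε ≤ δ := by
  constructor
  · intro h
    obtain ⟨x, hx⟩ := hA1
    obtain ⟨y, hy⟩ := hA0
    have hxy := h x y {true} (.of_discrete)
    have hyx := h y x {true} (.of_discrete)
    -- The empty event forces δ ≥ 0, which accounts for the 0 in the objective.
    have hxx := h x x ∅ .empty
    rw [berMechanism_apply_of_mem hA _ _ hx, berMechanism_apply_of_notMem hA _ _ hy, ber_real,
      ber_real] at hxy hyx
    simp at hxy hyx hxx
    rw [← hmax]
    exact max_le hxx (max_le (by linarith) (by linarith))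
  · intro h x y s _
    have h' : ldpObjective ε p₀ p₁ ≤ δ := hmax.le.trans h
    -- The event {0} has the complementary probabilities. Relabelling the output preserves capacity,
    -- so this pair is admissible too.
    have hc : ldpObjective ε (σ p₀) (σ p₁) ≤ δ :=
      (ldpObjective_le_deltaLDP (by rwa [bacCapacity_symm_symm]) ε).trans h
    simp only [ldpObjective, max_le_iff, coe_symm_eq] at h' hc
    obtain ⟨h0, h1, h2⟩ := h'
    obtain ⟨-, h3, h4⟩ := hc
    have hself (p : I) : (ber p).real s ≤ Real.exp ε * (ber p).real s + δ := by
      nlinarith [Real.one_le_exp hε, measureReal_nonneg (μ := ber p) (s := s)]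
    by_cases hx : x ∈ A <;> by_cases hy : y ∈ A <;>
      simp only [hx, hy, not_false_eq_true, berMechanism_apply_of_mem,
        berMechanism_apply_of_notMem]
    exacts [hself _, ber_real_le hε h0 h2 h4 s, ber_real_le hε h0 h1 h3 s, hself _]

end Extremal

/-! ### From mutual-information privacy to local differential privacy -/

section Conversion

variable {X Y : Type*} [MeasurableSpace X] [MeasurableSpace Y]

/-- Quantising the input and the output of a mechanism does not increase the mutual information. -/
lemma mutualInfo_quantize_le (P : Measure X) [IsProbabilityMeasure P] (M : Kernel X Y)
    [IsMarkovKernel M] {f : X → Bool} (hf : Measurable f) {g : Y → Bool} (hg : Measurable g)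
    (K : Kernel Bool Bool) [IsMarkovKernel K] (hK : ∀ᵐ x ∂P, (M x).map g = K (f x)) :
    mutualInfo (P.map f) K ≤ mutualInfo P M := by
  have hout : K ∘ₘ (P.map f) = (M ∘ₘ P).map g := by
    ext s hs
    rw [Measure.bind_apply hs K.aemeasurable, Measure.map_apply hg hs,
      Measure.bind_apply (hg hs) M.aemeasurable, lintegral_map (K.measurable_coe hs) hf]
    refine lintegral_congr_ae ?_
    filter_upwards [hK] with x hx
    rw [← hx, Measure.map_apply hg hs]
  have hjoint : P.map f ⊗ₘ K = (P ⊗ₘ M).map (Prod.map f g) := by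
    have := Measure.isProbabilityMeasure_map (μ := P) hf.aemeasurable
    have hfg : Measurable (Prod.map f g) := hf.prodMap hg
    ext s hs
    rw [Measure.compProd_apply hs, Measure.map_apply hfg hs, Measure.compProd_apply (hfg hs),
      lintegral_map (Kernel.measurable_kernel_prodMk_left hs) hf]
    refine lintegral_congr_ae ?_
    filter_upwards [hK] with x hx
    rw [← hx, Measure.map_apply hg (measurable_prodMk_left hs)]
    rfl
  have : IsProbabilityMeasure (M ∘ₘ P) := inferInstance
  rw [mutualInfo, mutualInfo, hout, hjoint, Measure.map_prod_map _ _ hf hg]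
  gcongr
  exact klDiv_map_le _ _ (hf.prodMap hg)

/-- The σ-algebra of X may fail to separate points, but a level set of z ↦ M(z)(E) separates those
that matter. -/
lemma exists_measurableSet_of_kernel_ne (M : Kernel X Y) {x x' : X} {E : Set Y}
    (hE : MeasurableSet E) (h : M x E ≠ M x' E) : ∃ A : Set X, MeasurableSet A ∧ x ∈ A ∧ x' ∉ A :=
  ⟨(fun z => M z E) ⁻¹' {M x E}, M.measurable_coe hE (measurableSet_singleton _), rfl,
    fun h' => h h'.symm⟩

lemma map_decide_eq_ber (Q : Measure Y) [IsProbabilityMeasure Q] {E : Set Y}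
    [DecidablePred (· ∈ E)] (hE : MeasurableSet E) :
    Q.map (fun y => decide (y ∈ E)) = ber ⟨Q.real E, measureReal_nonneg, measureReal_le_one⟩ := by
  refine Measure.ext_of_singleton fun b => ?_
  rw [Measure.map_apply (measurable_to_bool (by simpa [Set.preimage] using hE))
    (measurableSet_singleton _), ber_apply]
  cases b
  · simp [Set.preimage, ← probReal_compl_eq_one_sub hE]
    rfl
  · simp [Set.preimage]

lemma isLDP_of_isCILMIP {𝓓 : Set (ProbabilityMeasure X)} (h𝓓 : ContainsTwoPoint 𝓓) {μ : ℝ≥0∞}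
    (M : Kernel X Y) [IsMarkovKernel M] (hM : IsCILMIP 𝓓 μ M) (ε : ℝ) :
    IsLDP ε (deltaLDP μ ε) M := by
  classical
  intro x x' E hE
  let p (z : X) : I := ⟨(M z).real E, measureReal_nonneg, measureReal_le_one⟩
  suffices h : bacCapacity (p x') (σ (p x)) ≤ μ by
    have h' := ldpObjective_le_deltaLDP h ε
    simp only [ldpObjective, max_le_iff] at h'
    have := h'.2.2
    simp only [p] at this
    linarith
  by_cases hxx : M x E = M x' E
  · rw [bacCapacity_eq_zero]
    · exact zero_le
    · simp [p, measureReal_def, hxx]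
  obtain ⟨A, hA, hxA, hxA'⟩ := exists_measurableSet_of_kernel_ne M hE hxx
  have hf : Measurable fun z => decide (z ∈ A) :=
    measurable_to_bool (by simpa [Set.preimage] using hA)
  have hg : Measurable fun y => decide (y ∈ E) :=
    measurable_to_bool (by simpa [Set.preimage] using hE)
  rw [bacCapacity_eq_iSup]
  refine iSup_le fun t => ?_
  let P : ProbabilityMeasure X := ⟨bernoulliMeasure x x' t, inferInstance⟩
  refine le_trans ?_ (le_trans (le_iSup₂ (f := fun (P : ProbabilityMeasure X) (_ : P ∈ 𝓓) =>
    mutualInfo (P : Measure X) M) P (h𝓓 x x' t P rfl)) hM)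
  have hmap : (P : Measure X).map (fun z => decide (z ∈ A)) = ber t := by
    simp only [P, ProbabilityMeasure.coe_mk, map_bernoulliMeasure' _ _ hf, hxA, hxA', ber,
      decide_true, decide_false]
  refine le_trans (le_of_eq ?_) (mutualInfo_quantize_le (P : Measure X) M hf hg
    (berMechanism (MeasurableSet.of_discrete (s := {true})) (p x') (p x)) ?_)
  · rw [hmap, mutualInfo_berMechanism]
    simp [ber]
  -- Singletons of X need not be measurable, so the two-point law is tested on this measurable set,
  -- which contains x and x'.
  · have hs : MeasurableSet {z | M z E = if z ∈ A then M x E else M x' E} :=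
      measurableSet_eq_fun (M.measurable_coe hE)
        (Measurable.ite hA measurable_const measurable_const)
    have hmem : ∀ᵐ z ∂(P : Measure X), M z E = if z ∈ A then M x E else M x' E :=
      (mem_ae_iff_prob_eq_one hs).2
        (bernoulliMeasure_apply_of_mem_of_mem t hs (by simp [hxA]) (by simp [hxA']))
    filter_upwards [hmem] with z hz
    rw [map_decide_eq_ber (M z) hE]
    by_cases hzA : z ∈ A
    · rw [berMechanism_apply_of_mem _ _ _ (by simpa using hzA)]
      simp only [p, measureReal_def, hz, if_pos hzA]
    · rw [berMechanism_apply_of_notMem _ _ _ (by simpa using hzA)]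
      simp only [p, measureReal_def, hz, if_neg hzA]

end Conversion


/-! ### KL divergence and hockey-stick divergences -/

section DivergenceBound

lemma ofReal_intervalIntegral_le_setLIntegral {f : ℝ → ℝ} (hf : Continuous f) {a b : ℝ}
    (hab : a ≤ b) (h : ∀ x ∈ Set.Ioc a b, 0 ≤ f x) :
    ENNReal.ofReal (∫ x in a..b, f x) ≤ ∫⁻ x in Set.Ioi a, ENNReal.ofReal (f x) := by
  rw [intervalIntegral.integral_of_le hab, ofReal_integral_eq_lintegral_ofReal
    (hf.integrableOn_Ioc) ((ae_restrict_iff' measurableSet_Ioc).2 (.of_forall h))]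
  exact lintegral_mono_set Set.Ioc_subset_Ioi_self

/-- The integrand of the representation of the Kullback-Leibler divergence by hockey-stick
divergences. -/
noncomputable def hockeyStickIntegrand (r : ℝ≥0∞) (ε : ℝ) : ℝ≥0∞ :=
  (r - ENNReal.ofReal (Real.exp ε))
    + ENNReal.ofReal (Real.exp (-ε)) * (1 - ENNReal.ofReal (Real.exp ε) * r)

/-- For r ≥ 1, `klFun r` is the integral of r - e^ε over 0 < ε ≤ log r; for 0 < r < 1, that of
e^{-ε} - r over 0 < ε ≤ -log r. Each integrand is bounded by one summand of `hockeyStickIntegrand`.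
-/
lemma ofReal_klFun_le {r : ℝ≥0∞} (hr : r ≠ ∞) :
    ENNReal.ofReal (klFun r.toReal) ≤ ∫⁻ ε in Set.Ioi (0 : ℝ), hockeyStickIntegrand r ε := by
  obtain ⟨r, hr0, rfl⟩ : ∃ x : ℝ, 0 ≤ x ∧ ENNReal.ofReal x = r :=
    ⟨r.toReal, ENNReal.toReal_nonneg, ENNReal.ofReal_toReal hr⟩
  rw [ENNReal.toReal_ofReal hr0]
  have hleft (ε : ℝ) : ENNReal.ofReal (r - Real.exp ε) ≤
      hockeyStickIntegrand (ENNReal.ofReal r) ε := by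
    rw [hockeyStickIntegrand, ENNReal.ofReal_sub _ (Real.exp_pos ε).le]
    exact le_self_add
  have hright (ε : ℝ) : ENNReal.ofReal (Real.exp (-ε) - r) ≤
      hockeyStickIntegrand (ENNReal.ofReal r) ε := by
    rw [hockeyStickIntegrand, ← ENNReal.ofReal_mul (Real.exp_pos ε).le, ← ENNReal.ofReal_one,
      ← ENNReal.ofReal_sub 1 (by positivity), ← ENNReal.ofReal_mul (Real.exp_pos _).le, mul_sub,
      ← mul_assoc, ← Real.exp_add, neg_add_cancel, Real.exp_zero, mul_one, one_mul]
    exact le_add_self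
  rcases le_or_gt 1 r with h1 | h1
  · have h0 : 0 < r := by linarith
    have hint : ∫ ε in (0 : ℝ)..Real.log r, (r - Real.exp ε) = klFun r := by
      rw [intervalIntegral.integral_sub (by simp) (by simp), integral_exp, Real.exp_log h0,
        intervalIntegral.integral_const, klFun_apply, Real.exp_zero, smul_eq_mul]
      ring
    rw [← hint]
    refine (ofReal_intervalIntegral_le_setLIntegral (by fun_prop) (Real.log_nonneg h1) ?_).trans
      (lintegral_mono hleft)
    intro ε hε
    have := (Real.le_log_iff_exp_le h0).1 hε.2
    linarith
  -- At r = 0 the range of integration becomes the whole half-line, while `Real.log 0 = 0`, so this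
  -- case is separate.
  · rcases hr0.eq_or_lt with rfl | h0
    · have hexp : IntegrableOn (fun x : ℝ => Real.exp (-x)) (Set.Ioi 0) := by
        simpa using exp_neg_integrableOn_Ioi 0 one_pos
      have : ENNReal.ofReal (klFun 0) =
          ∫⁻ ε in Set.Ioi (0 : ℝ), ENNReal.ofReal (Real.exp (-ε)) := by
        rw [← ofReal_integral_eq_lintegral_ofReal hexp (.of_forall fun x => (Real.exp_pos _).le),
          integral_exp_neg_Ioi_zero, klFun_zero]
      rw [this]
      exact lintegral_mono fun ε => by simpa using hright ε
    · have hint : ∫ ε in (0 : ℝ)..(-Real.log r), (Real.exp (-ε) - r) = klFun r := by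
        rw [intervalIntegral.integral_sub (Continuous.intervalIntegrable (by fun_prop) _ _)
          (by simp), intervalIntegral.integral_comp_neg (fun x => Real.exp x), integral_exp,
          neg_neg, neg_zero, Real.exp_log h0, intervalIntegral.integral_const, klFun_apply,
          Real.exp_zero, smul_eq_mul]
        ring
      rw [← hint]
      refine (ofReal_intervalIntegral_le_setLIntegral (by fun_prop)
        (neg_nonneg.2 (Real.log_nonpos h0.le h1.le)) ?_).trans (lintegral_mono hright)
      intro ε hε
      have := (Real.log_le_iff_le_exp h0).1 (le_neg_of_le_neg hε.2)
      linarith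

variable {Z : Type*} [MeasurableSpace Z]

/-- The truncated difference lives on {g < f}, so testing the hypothesis on this one set suffices.
-/
lemma lintegral_tsub_le {ν : Measure Z} {f g : Z → ℝ≥0∞} (hf : Measurable f) (hg : Measurable g)
    (hg' : ∫⁻ z, g z ∂ν ≠ ∞) {d : ℝ≥0∞}
    (h : ∀ s, MeasurableSet s → ∫⁻ z in s, f z ∂ν ≤ ∫⁻ z in s, g z ∂ν + d) :
    ∫⁻ z, f z - g z ∂ν ≤ d := by
  have hs : MeasurableSet {z | g z < f z} := measurableSet_lt hg hf
  calc ∫⁻ z, f z - g z ∂ν = ∫⁻ z in {z | g z < f z}, f z - g z ∂ν := by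
        rw [← lintegral_indicator hs]
        refine lintegral_congr fun z => ?_
        by_cases hz : g z < f z
        · simp [hz]
        · simp [hz, tsub_eq_zero_of_le (not_lt.1 hz)]
    _ = ∫⁻ z in {z | g z < f z}, f z ∂ν - ∫⁻ z in {z | g z < f z}, g z ∂ν :=
        lintegral_sub hg (ne_top_of_le_ne_top hg' (setLIntegral_le_lintegral _ _))
          ((ae_restrict_iff' hs).2 (.of_forall fun z (hz : g z < f z) => hz.le))
    _ ≤ d := tsub_le_iff_left.2 (h _ hs)

/-- Two finite measures that are `(ε, δ ε)`-indistinguishable for all `ε > 0` have a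
Kullback-Leibler divergence of at most `∫ (1 + e^{-ε}) δ(ε) dε`. -/
lemma klDiv_le_lintegral {μ ν : Measure Z} [IsFiniteMeasure μ] [IsFiniteMeasure ν] {δ : ℝ → ℝ}
    (hμν : ∀ ε : ℝ, 0 < ε → ∀ s, MeasurableSet s →
      μ s ≤ ENNReal.ofReal (Real.exp ε) * ν s + ENNReal.ofReal (δ ε))
    (hνμ : ∀ ε : ℝ, 0 < ε → ∀ s, MeasurableSet s →
      ν s ≤ ENNReal.ofReal (Real.exp ε) * μ s + ENNReal.ofReal (δ ε)) :
    klDiv μ ν ≤ ∫⁻ ε in Set.Ioi (0 : ℝ), ENNReal.ofReal ((1 + Real.exp (-ε)) * δ ε) := by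
  have hδ (ε : ℝ) : ENNReal.ofReal ((1 + Real.exp (-ε)) * δ ε)
      = ENNReal.ofReal (δ ε) + ENNReal.ofReal (Real.exp (-ε)) * ENNReal.ofReal (δ ε) := by
    rw [ENNReal.ofReal_mul (by positivity), ENNReal.ofReal_add zero_le_one (Real.exp_pos _).le,
      ENNReal.ofReal_one, add_mul, one_mul]
  simp only [hδ]
  by_cases hac : μ ≪ ν
  · have hr := Measure.measurable_rnDeriv μ ν
    rw [klDiv_eq_lintegral_klFun_of_ac hac]
    calc ∫⁻ z, ENNReal.ofReal (klFun (μ.rnDeriv ν z).toReal) ∂ν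
        ≤ ∫⁻ z, (∫⁻ ε in Set.Ioi (0 : ℝ), hockeyStickIntegrand (μ.rnDeriv ν z) ε) ∂ν := by
          refine lintegral_mono_ae ?_
          filter_upwards [μ.rnDeriv_ne_top ν] with z hz using ofReal_klFun_le hz
      _ = ∫⁻ ε in Set.Ioi (0 : ℝ), ∫⁻ z, hockeyStickIntegrand (μ.rnDeriv ν z) ε ∂ν := by
          refine lintegral_lintegral_swap ?_
          unfold Function.uncurry hockeyStickIntegrand
          fun_prop
      _ ≤ _ := by
          refine setLIntegral_mono' measurableSet_Ioi fun ε hε => ?_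
          unfold hockeyStickIntegrand
          rw [lintegral_add_left (by fun_prop), lintegral_const_mul _ (by fun_prop)]
          gcongr
          · refine lintegral_tsub_le hr measurable_const ?_ fun s hs => ?_
            · simp [ENNReal.mul_eq_top]
            · rw [Measure.setLIntegral_rnDeriv hac, setLIntegral_const]
              exact hμν ε hε s hs
          · refine lintegral_tsub_le measurable_const (by fun_prop) ?_ fun s hs => ?_
            · rw [lintegral_const_mul _ hr, Measure.lintegral_rnDeriv hac]
              simp [ENNReal.mul_eq_top]
            · rw [lintegral_const_mul _ hr, Measure.setLIntegral_rnDeriv hac, setLIntegral_const,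
                one_mul]
              exact hνμ ε hε s hs
  -- Without absolute continuity, a ν-null set of positive μ-measure forces δ(ε) ≥ μ(s) > 0 for all
  -- ε > 0, so the right-hand side is infinite.
  · have : ∃ s, MeasurableSet s ∧ ν s = 0 ∧ μ s ≠ 0 := by
      by_contra! h
      exact hac (Measure.AbsolutelyContinuous.mk h)
    obtain ⟨s, hs, hν, hμ⟩ := this
    refine le_top.trans ?_
    calc (∞ : ℝ≥0∞) = ∫⁻ _ in Set.Ioi (0 : ℝ), μ s := by
          rw [setLIntegral_const, Real.volume_Ioi, ENNReal.mul_top hμ]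
      _ ≤ _ := by
          refine setLIntegral_mono' measurableSet_Ioi fun ε hε => ?_
          have := hμν ε hε s hs
          rw [hν, mul_zero, zero_add] at this
          exact this.trans le_self_add

end DivergenceBound

/-! ### From local differential privacy to mutual-information privacy -/

section Converse

variable {X Y : Type*} [MeasurableSpace X] [MeasurableSpace Y]

lemma IsLDP.apply_le {ε δ : ℝ} {M : Kernel X Y} [IsMarkovKernel M] (h : IsLDP ε δ M) (x x' : X)
    {s : Set Y} (hs : MeasurableSet s) :
    M x s ≤ ENNReal.ofReal (Real.exp ε) * M x' s + ENNReal.ofReal δ := by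
  have := ENNReal.ofReal_le_ofReal (h x x' s hs)
  rw [ofReal_measureReal] at this
  refine this.trans (ENNReal.ofReal_add_le.trans_eq ?_)
  rw [ENNReal.ofReal_mul (Real.exp_pos ε).le, ofReal_measureReal]

lemma lintegral_mul_add_const (P : Measure X) [IsProbabilityMeasure P] {f : X → ℝ≥0∞}
    (hf : Measurable f) (c d : ℝ≥0∞) : ∫⁻ x, c * f x + d ∂P = c * ∫⁻ x, f x ∂P + d := by
  rw [lintegral_add_right _ measurable_const, lintegral_const_mul _ hf, lintegral_const,
    measure_univ, mul_one]

/-- The LDP inequality is affine in each output law, so either input can be averaged; δ is unchanged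
because P has mass 1. -/
lemma IsLDP.apply_le_comp {ε δ : ℝ} {M : Kernel X Y} [IsMarkovKernel M] (h : IsLDP ε δ M)
    (P : Measure X) [IsProbabilityMeasure P] (x : X) {s : Set Y} (hs : MeasurableSet s) :
    M x s ≤ ENNReal.ofReal (Real.exp ε) * (M ∘ₘ P) s + ENNReal.ofReal δ := by
  rw [Measure.bind_apply hs M.aemeasurable, ← lintegral_mul_add_const P (M.measurable_coe hs)]
  calc M x s = ∫⁻ _, M x s ∂P := by simp
    _ ≤ _ := lintegral_mono fun x' => h.apply_le x x' hs

lemma IsLDP.comp_apply_le {ε δ : ℝ} {M : Kernel X Y} [IsMarkovKernel M] (h : IsLDP ε δ M)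
    (P : Measure X) [IsProbabilityMeasure P] (x : X) {s : Set Y} (hs : MeasurableSet s) :
    (M ∘ₘ P) s ≤ ENNReal.ofReal (Real.exp ε) * M x s + ENNReal.ofReal δ := by
  rw [Measure.bind_apply hs M.aemeasurable]
  calc ∫⁻ x', M x' s ∂P ≤ ∫⁻ _, (ENNReal.ofReal (Real.exp ε) * M x s + ENNReal.ofReal δ) ∂P :=
        lintegral_mono fun x' => h.apply_le x' x hs
    _ = _ := by simp

/-- Over each x the section of s is an event for M(x) against the output marginal; integrating over
x keeps the constants. -/
lemma IsLDP.compProd_le_prod {ε δ : ℝ} {M : Kernel X Y} [IsMarkovKernel M] (h : IsLDP ε δ M)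
    (P : Measure X) [IsProbabilityMeasure P] {s : Set (X × Y)} (hs : MeasurableSet s) :
    (P ⊗ₘ M) s ≤ ENNReal.ofReal (Real.exp ε) * (P.prod (M ∘ₘ P)) s + ENNReal.ofReal δ := by
  rw [Measure.compProd_apply hs, Measure.prod_apply hs,
    ← lintegral_mul_add_const P (measurable_measure_prodMk_left hs)]
  exact lintegral_mono fun x => h.apply_le_comp P x (measurable_prodMk_left hs)

lemma IsLDP.prod_le_compProd {ε δ : ℝ} {M : Kernel X Y} [IsMarkovKernel M] (h : IsLDP ε δ M)
    (P : Measure X) [IsProbabilityMeasure P] {s : Set (X × Y)} (hs : MeasurableSet s) :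
    (P.prod (M ∘ₘ P)) s ≤ ENNReal.ofReal (Real.exp ε) * (P ⊗ₘ M) s + ENNReal.ofReal δ := by
  rw [Measure.compProd_apply hs, Measure.prod_apply hs,
    ← lintegral_mul_add_const P (Kernel.measurable_kernel_prodMk_left hs)]
  exact lintegral_mono fun x => h.comp_apply_le P x (measurable_prodMk_left hs)

lemma isCILMIP_muCI (𝓓 : Set (ProbabilityMeasure X)) (δ : ℝ → ℝ) (M : Kernel X Y)
    [IsMarkovKernel M] (h : ∀ ε : ℝ, 0 < ε → IsLDP ε (δ ε) M) : IsCILMIP 𝓓 (muCI δ) M := by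
  refine iSup₂_le fun P _ => ?_
  have hl : 0 < Real.log 2 := Real.log_pos one_lt_two
  rw [mutualInfo, muCI, Real.logb, Real.log_exp, one_div, ENNReal.ofReal_inv_of_pos hl, mul_comm,
    ← div_eq_mul_inv]
  gcongr
  exact klDiv_le_lintegral (fun ε hε s hs => (h ε hε).compProd_le_prod _ hs)
    (fun ε hε s hs => (h ε hε).prod_le_compProd _ hs)

end Converse

end LocalPrivacy

theorem theorem1 {X Y : Type*} [MeasurableSpace X] [MeasurableSpace Y]
    (𝓓 : Set (ProbabilityMeasure X)) :
    -- the capacity of the binary asymmetric channel in closed form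
    (∀ a b : I,
      ((a : ℝ) ≤ min (b : ℝ) (min (1 - b) (1 / 2)) → (a : ℝ) + b ≠ 1 →
        LocalPrivacy.bacCapacity a b ≠ ∞ ∧
          (LocalPrivacy.bacCapacity a b).toReal = LocalPrivacy.bacFormula a b) ∧
      ((a : ℝ) + b = 1 → LocalPrivacy.bacCapacity a b = 0) ∧
      (b < a → LocalPrivacy.bacCapacity a b = LocalPrivacy.bacCapacity b a) ∧
      (σ b < a → LocalPrivacy.bacCapacity a b = LocalPrivacy.bacCapacity (σ b) (σ a)) ∧
      (1 / 2 < (a : ℝ) →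
        LocalPrivacy.bacCapacity a b = LocalPrivacy.bacCapacity (σ a) (σ b))) ∧
    -- (a), the maximum that defines `δ^LDP_μ(ε)` is attained
    (∀ (μ : ℝ≥0∞) (ε : ℝ), 0 < ε →
      IsGreatest (LocalPrivacy.ldpValues μ ε) (LocalPrivacy.deltaLDP μ ε)) ∧
    -- (a), conversion
    (LocalPrivacy.ContainsTwoPoint 𝓓 →
      ∀ (μ : ℝ≥0∞) (M : Kernel X Y) [IsMarkovKernel M], LocalPrivacy.IsCILMIP 𝓓 μ M →
        ∀ ε : ℝ, 0 < ε → LocalPrivacy.IsLDP ε (LocalPrivacy.deltaLDP μ ε) M) ∧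
    -- (a), tightness: a Bernoulli mechanism whose smallest admissible `δ` is `δ^LDP_μ(ε)`
    (∀ (A : Set X) (hA : MeasurableSet A), A.Nonempty → Aᶜ.Nonempty →
      ∀ (μ : ℝ≥0∞) (ε : ℝ), 0 < ε →
        ∃ p₀ p₁ : I,
          LocalPrivacy.bacCapacity p₀ (σ p₁) ≤ μ ∧
          LocalPrivacy.ldpObjective ε p₀ p₁ = LocalPrivacy.deltaLDP μ ε ∧
          IsMarkovKernel (LocalPrivacy.berMechanism hA p₀ p₁) ∧
          LocalPrivacy.IsCILMIP 𝓓 μ (LocalPrivacy.berMechanism hA p₀ p₁) ∧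
          ∀ δ : ℝ, LocalPrivacy.IsLDP ε δ (LocalPrivacy.berMechanism hA p₀ p₁) ↔
            LocalPrivacy.deltaLDP μ ε ≤ δ) ∧
    -- (b)
    (∀ (δ : ℝ → ℝ) (M : Kernel X Y) [IsMarkovKernel M],
      (∀ ε : ℝ, 0 < ε → LocalPrivacy.IsLDP ε (δ ε) M) →
        LocalPrivacy.IsCILMIP 𝓓 (LocalPrivacy.muCI δ) M) := by
  refine ⟨fun a b => ⟨fun h hab => ?_, LocalPrivacy.bacCapacity_eq_zero,
      fun _ => LocalPrivacy.bacCapacity_swap a b, fun _ => ?_,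
      fun _ => (LocalPrivacy.bacCapacity_symm_symm a b).symm⟩,
    fun μ ε _ => LocalPrivacy.isGreatest_deltaLDP μ ε,
    fun h𝓓 μ M _ hM ε _ => LocalPrivacy.isLDP_of_isCILMIP h𝓓 M hM ε,
    fun A hA hA1 hA0 μ ε hε => ?_,
    fun δ M _ h => LocalPrivacy.isCILMIP_muCI 𝓓 δ M h⟩
  · have := h.trans ((min_le_right _ _).trans (min_le_left _ _))
    exact LocalPrivacy.bacCapacity_closedForm (lt_of_le_of_ne (by linarith) hab)
  · rw [LocalPrivacy.bacCapacity_symm_symm, LocalPrivacy.bacCapacity_swap]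
  · obtain ⟨p₀, p₁, hp, hmax⟩ := (LocalPrivacy.isGreatest_deltaLDP μ ε).1
    exact ⟨p₀, p₁, hp, hmax.symm, inferInstance,
      iSup₂_le fun P _ => (LocalPrivacy.mutualInfo_berMechanism_le _ hA p₀ p₁).trans hp,
      LocalPrivacy.isLDP_berMechanism_iff hA hA1 hA0 hε.le hp hmax.symm⟩
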